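/- **Definitions.** A Petri net $\mathcal N=(P,T,\mathrm{Pre},\mathrm{Post})$ consists of finite sets $P$ (places) and $T$ (transitions) and $P\times T$ matrices $\mathrm{Pre},\mathrm{Post}$ over $\mathbb N$; put $\mathcal A=\mathrm{Post}-\mathrm{Pre}$, let the weight $w$ be the largest entry of $\mathrm{Pre}$ and $\mathrm{Post}$, and let the size $|\mathcal N|$ be the number of bits of the encoding of $\mathcal N$ that lists $|P|$, $|T|$ and all entries of the two matrices in (self-delimiting) binary. For a vector $v$ with non-negative entries let $\|v\|=\sum_e v(e)$; for $x\in\mathbb N$ let $\mathrm{bits}(x)=\lceil\log_2(x+1)\rceil$ be its number of binary digits. *Standard semantics.* For markings $M,M'\in\mathbb N^P$ and $t\in T$ write $M\xrightarrow{t}M'$ if $M(p)\ge \mathrm{Pre}[p,t]$ and $M'(p)=M(p)+\mathcal A[p,t]$ for all $p\in P$; for a firing sequence $\tau=t_1\cdots t_r\in T^*$, $M\xrightarrow{\tau}M'$ means that $M'$ is reached from $M$ by firing $t_1,\dots,t_r$ one after the other. The support $\mathrm{supp}(\tau)$ is the set of transitions that occur in $\tau$. *Continuous semantics.* For continuous markings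 $M,M'\in\mathbb Q_{\ge0}^P$, $\lambda\in\mathbb Q_{\ge0}$ and $t\in T$ write $M\xrightarrow[\mathbb Q]{\lambda t}M'$ if $M(p)\ge\lambda\,\mathrm{Pre}[p,t]$ and $M'(p)=M(p)+\lambda\,\mathcal A[p,t]$ for all $p\in P$; this extends to continuous firing sequences $\sigma=\lambda_1t_1,\dots,\lambda_rt_r\in(\mathbb Q_{\ge0}\times T)^*$. The Parikh image $\vec\sigma\in\mathbb Q_{\ge0}^T$ is given by $\vec\sigma[t]=\sum_{i:\,t_i=t}\lambda_i$, and $\mathrm{supp}(\sigma)=\{t:\vec\sigma[t]\ne0\}$. **Scaling Lemma.** 1. There is a polynomial $q$ with coefficients in $\mathbb N$ such that for every Petri net $\mathcal N$, all markings $M,M'\in\mathbb N^P$ and every continuous firing sequence $\sigma$ with $M\xrightarrow[\mathbb Q]{\sigma}M'$ there are an integer $n\ge1$ with $$\mathrm{bits}(n)\le q\bigl(|\mathcal N|\,(\mathrm{bits}(\|M\|)+\mathrm{bits}(\|M'\|))\bigr)$$ and a firing sequence $\tau\in T^*$ with $\mathrm{supp}(\tau)=\mathrm{supp}(\sigma)$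 and $nM\xrightarrow{\tau}nM'$. 2. Moreover, suppose that $M\xrightarrow[\mathbb Q]{\sigma}M'$ with $M,M'\in\mathbb N^P$, and let $m=|\mathrm{supp}(\sigma)|$, $\ell=\|\vec\sigma\|$ and $k$ be the least positive integer with $k\vec\sigma\in\mathbb N^T$. Then $n_0=16\,w\,(w+1)^{2m}k^2\ell$ is a natural number, and there is $\tau\in T^*$ with $\mathrm{supp}(\tau)=\mathrm{supp}(\sigma)$ and $n_0M\xrightarrow{\tau}n_0M'$. -/

import Mathlib

/-- A Petri net with places `P` and transitions `T` (both are taken to be finite in what follows),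
given by its `P × T` matrices `Pre` and `Post` with entries in `ℕ`. -/
structure PetriNet (P : Type*) (T : Type*) where
  pre : P → T → ℕ
  post : P → T → ℕ

/-- The size `‖v‖ = ∑ e, |v e|` of a vector over a semiring of non-negative numbers
(here `ℕ` or `ℚ≥0`, so no absolute values are needed). -/
def vecSize {E S : Type*} [Fintype E] [AddCommMonoid S] (v : E → S) : S :=
  ∑ e, v e

/-- A self-delimiting binary code of a natural number: every binary digit of `n` (least significant
digit first) is preceded by the bit `1`, and the bit `0` ends the code. -/
def natCode (n : ℕ) : List Bool :=
  n.bits.flatMap (fun b => [true, b]) ++ [false]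

/-- The length of the code of `n` is twice the number of binary digits of `n`, plus one. -/
theorem natCode_length (n : ℕ) : (natCode n).length = 2 * Nat.size n + 1 := by
  simp [natCode, List.length_flatMap, Nat.size_eq_bits_len, mul_comm]

/-- Codes can be read off unambiguously from the beginning of a word. -/
theorem natCode_append_inj {a b : ℕ} {u v : List Bool}
    (h : natCode a ++ u = natCode b ++ v) : a = b ∧ u = v := by
  have key : ∀ (x y : List Bool) (u v : List Bool),
      x.flatMap (fun b => [true, b]) ++ [false] ++ u =
        y.flatMap (fun b => [true, b]) ++ [false] ++ v → x = y ∧ u = v := by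
    intro x
    induction x with
    | nil => intro y u v h; cases y <;> simp_all
    | cons c x ih =>
      intro y u v h
      cases y with
      | nil => simp at h
      | cons d y =>
        simp only [List.flatMap_cons, List.append_assoc, List.cons_append, List.nil_append,
          List.cons.injEq, true_and] at h
        obtain ⟨hcd, h⟩ := h
        have := ih y u v (by simpa using h)
        exact ⟨by rw [hcd, this.1], this.2⟩
  obtain ⟨h1, h2⟩ := key _ _ _ _ h
  refine ⟨?_, h2⟩
  have := congrArg (fun l : List Bool => l.foldr Nat.bit 0) h1
  have dec : ∀ n : ℕ, n.bits.foldr Nat.bit 0 = n := by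
    intro n
    induction n using Nat.binaryRec' with
    | zero => simp
    | bit b n hn ih => rw [Nat.bits_append_bit n b hn]; simp [ih]
  simpa [dec] using this

/-- Words made of codes that can be read off unambiguously can be read off unambiguously. -/
theorem flatMap_append_inj {E : Type*} (f g : E → List Bool) (l : List E) (R : E → Prop)
    (hR : ∀ e ∈ l, ∀ u v, f e ++ u = g e ++ v → R e ∧ u = v) (u v : List Bool)
    (h : l.flatMap f ++ u = l.flatMap g ++ v) : (∀ e ∈ l, R e) ∧ u = v := by
  induction l generalizing u v with
  | nil => simpa using h
  | cons e l ih =>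
    simp only [List.flatMap_cons, List.append_assoc] at h
    obtain ⟨h1, h2⟩ := hR e (by simp) _ _ h
    obtain ⟨h3, h4⟩ := ih (fun e he => hR e (by simp [he])) u v h2
    exact ⟨by simpa using ⟨h1, h3⟩, h4⟩

namespace PetriNet

variable {P : Type*} {T : Type*}

/-- The incidence matrix `Post - Pre`, with integer entries. -/
def incidence (N : PetriNet P T) : P → T → ℤ :=
  fun p t => (N.post p t : ℤ) - (N.pre p t : ℤ)

/-- The weight of the net: the largest entry of the matrices `Pre` and `Post`. -/
def weight [Fintype P] [Fintype T] (N : PetriNet P T) : ℕ :=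
  Finset.univ.sup fun p : P => Finset.univ.sup fun t : T => max (N.pre p t) (N.post p t)

/-- The encoding of a net as a word over `{0,1}`: the number of places, the number of transitions,
and all the entries of the two matrices, row by row, in binary. The places and the transitions are
listed in an arbitrary order, on which the length of the word does not depend. -/
noncomputable def encode [Fintype P] [Fintype T] (N : PetriNet P T) : List Bool :=
  natCode (Fintype.card P) ++ (natCode (Fintype.card T) ++
    (Finset.univ : Finset P).toList.flatMap fun p =>
      (Finset.univ : Finset T).toList.flatMap fun t =>
        natCode (N.pre p t) ++ natCode (N.post p t))

/-- The size `|N|` of a net: the number of bits of its encoding. -/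
noncomputable def size [Fintype P] [Fintype T] (N : PetriNet P T) : ℕ :=
  N.encode.length

theorem size_eq [Fintype P] [Fintype T] (N : PetriNet P T) :
    N.size = (2 * Nat.size (Fintype.card P) + 1) + ((2 * Nat.size (Fintype.card T) + 1) +
      ∑ p, ∑ t, ((2 * Nat.size (N.pre p t) + 1) + (2 * Nat.size (N.post p t) + 1))) := by
  simp only [size, encode, List.length_append, natCode_length, List.length_flatMap,
    Finset.sum_map_toList]

/-- The encoding determines the net. -/
theorem encode_injective [Fintype P] [Fintype T] :
    Function.Injective (encode : PetriNet P T → List Bool) := by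
  intro N N' h
  have h1 := congrArg (· ++ []) (natCode_append_inj (natCode_append_inj h).2).2
  have h2 : ∀ p ∈ (Finset.univ : Finset P).toList, ∀ t ∈ (Finset.univ : Finset T).toList,
      N.pre p t = N'.pre p t ∧ N.post p t = N'.post p t := by
    refine (flatMap_append_inj _ _ _ _ ?_ _ _ h1).1
    intro p _ u v hp
    refine flatMap_append_inj _ _ _ _ ?_ u v hp
    intro t _ u v ht
    simp only [List.append_assoc] at ht
    obtain ⟨h3, h4⟩ := natCode_append_inj ht
    obtain ⟨h5, h6⟩ := natCode_append_inj h4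
    exact ⟨⟨h3, h5⟩, h6⟩
  have h3 : ∀ p t, N.pre p t = N'.pre p t ∧ N.post p t = N'.post p t := fun p t =>
    h2 p (by simp) t (by simp)
  cases N; cases N'
  simp only [PetriNet.mk.injEq]
  exact ⟨by ext p t; exact (h3 p t).1, by ext p t; exact (h3 p t).2⟩

/-- Standard semantics: `M'` is reached from the marking `M` by firing the transition `t`. -/
def Fires (N : PetriNet P T) (M : P → ℕ) (t : T) (M' : P → ℕ) : Prop :=
  ∀ p, N.pre p t ≤ M p ∧ (M' p : ℤ) = (M p : ℤ) + N.incidence p t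

/-- Standard semantics: `M'` is reached from the marking `M` by the firing sequence `τ`. -/
def FiresSeq (N : PetriNet P T) : (P → ℕ) → List T → (P → ℕ) → Prop
  | M, [], M' => M = M'
  | M, t :: τ, M' => ∃ L : P → ℕ, N.Fires M t L ∧ N.FiresSeq L τ M'

/-- Continuous semantics: the continuous marking `M` enables `t` with factor `c`, and `M'` is
reached from `M` by firing `c t`. -/
def ContFires (N : PetriNet P T) (M : P → ℚ≥0) (c : ℚ≥0) (t : T) (M' : P → ℚ≥0) : Prop :=
  ∀ p, c * (N.pre p t : ℚ≥0) ≤ M p ∧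
    (M' p : ℚ) = (M p : ℚ) + (c : ℚ) * (N.incidence p t : ℚ)

/-- Continuous semantics: `M'` is reached from the continuous marking `M` by the continuous firing
sequence `σ = c₁ t₁, …, cₖ tₖ`. -/
def ContFiresSeq (N : PetriNet P T) : (P → ℚ≥0) → List (ℚ≥0 × T) → (P → ℚ≥0) → Prop
  | M, [], M' => M = M'
  | M, x :: σ, M' => ∃ L : P → ℚ≥0, N.ContFires M x.1 x.2 L ∧ N.ContFiresSeq L σ M'

end PetriNet

/-- A marking, seen as a continuous marking. -/
def toContMarking {P : Type*} (M : P → ℕ) : P → ℚ≥0 :=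
  fun p => (M p : ℚ≥0)

/-- The support of a firing sequence: the set of transitions that appear in it. -/
def seqSupp {T : Type*} (τ : List T) : Set T :=
  {t | t ∈ τ}

open Classical in
/-- The Parikh image of a continuous firing sequence: the transition `t` is mapped to the sum of the
factors with which it is fired. -/
noncomputable def contParikh {T : Type*} (σ : List (ℚ≥0 × T)) : T → ℚ≥0 :=
  fun t => (σ.map fun x => if x.2 = t then x.1 else 0).sum

/-- The support of a continuous firing sequence: the support of its Parikh image. -/
def contSupp {T : Type*} (σ : List (ℚ≥0 × T)) : Set T :=
  Function.support (contParikh σ)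

/-- `k` is the least positive integer for which all the entries of `k x` are natural numbers. -/
def IsLeastDenominator {T : Type*} (x : T → ℚ≥0) (k : ℕ) : Prop :=
  IsLeast {j : ℕ | 0 < j ∧ ∀ t, ∃ a : ℕ, (j : ℚ≥0) * x t = (a : ℚ≥0)} k

universe u v

/-! Let `z` be a natural vector with support `supp σ` and `𝒜 z = k (M' - M)`. Ordering `supp σ` by
first firing with a nonzero factor, each transition consumes only from places marked in `M` or fed
by earlier transitions (`EnabledFrom`). From a large multiple of `M`, firing along this order with
geometrically decreasing multiplicities leaves at least `g` tokens on every touched place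
(`EnabledFrom.exists_firesSeq`). Reversing all arcs gives the same from `M'`.

The two phases have Parikh images `g u` and `g v`, where `u + v ≤ b z` as soon as `b ≥ 2 (w + 1) ^
m`. What remains is `g (b z - u - v)`: `g` repetitions of one word of length at most `b ∑ z`. Its
intermediate markings interpolate linearly between two markings with at least `g` tokens on the
touched places, so `g ≥ w b ∑ z` suffices. This yields a run from `g b k M` to `g b k M'`
(`exists_firesSeq_smul`).

The second claim takes `z = k σ⃗`. For the first, `(1, σ⃗)` lies in the kernel of the integer matrix
`[M - M' | 𝒜]`; Cramer's rule on supports that cannot be shrunk gives a natural kernel vector with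
the same support and entries of polynomially many bits (`exists_nat_kernel`). -/

namespace PetriNet

/-! ### Reversal and concatenation of runs -/

variable {P T : Type*}

/-- The net with all arcs reversed. -/
def reversed (N : PetriNet P T) : PetriNet P T := ⟨N.post, N.pre⟩

theorem incidence_reversed (N : PetriNet P T) (p : P) (t : T) :
    N.reversed.incidence p t = -N.incidence p t := by
  simp [incidence, reversed]

theorem Fires.reversed {N : PetriNet P T} {M M' : P → ℕ} {t : T} (h : N.Fires M t M') :
    N.reversed.Fires M' t M := by
  intro p
  obtain ⟨h1, h2⟩ := h p
  rw [incidence_reversed]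
  simp only [incidence] at *
  refine ⟨?_, by omega⟩
  change N.post p t ≤ M' p
  omega

theorem FiresSeq.append {N : PetriNet P T} {τ τ' : List T} {M L M' : P → ℕ}
    (h : N.FiresSeq M τ L) (h' : N.FiresSeq L τ' M') : N.FiresSeq M (τ ++ τ') M' := by
  induction τ generalizing M with
  | nil => cases h; exact h'
  | cons t τ ih =>
    obtain ⟨K, h1, h2⟩ := h
    exact ⟨K, h1, ih h2⟩

theorem FiresSeq.reversed {N : PetriNet P T} {τ : List T} {M M' : P → ℕ}
    (h : N.FiresSeq M τ M') : N.reversed.FiresSeq M' τ.reverse M := by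
  induction τ generalizing M with
  | nil => exact Eq.symm h
  | cons t τ ih =>
    obtain ⟨K, h1, h2⟩ := h
    rw [List.reverse_cons]
    exact (ih h2).append ⟨M, h1.reversed, rfl⟩

theorem ContFires.reversed {N : PetriNet P T} {M M' : P → ℚ≥0} {c : ℚ≥0} {t : T}
    (h : N.ContFires M c t M') : N.reversed.ContFires M' c t M := by
  intro p
  obtain ⟨h1, h2⟩ := h p
  rw [incidence_reversed]
  have h1' : (c : ℚ) * N.pre p t ≤ M p := by exact_mod_cast h1
  simp only [incidence] at *
  push_cast at *
  refine ⟨?_, by linarith⟩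
  have : (c : ℚ) * N.post p t ≤ M' p := by rw [h2]; linarith
  exact_mod_cast this

theorem ContFiresSeq.append {N : PetriNet P T} {σ σ' : List (ℚ≥0 × T)} {M L M' : P → ℚ≥0}
    (h : N.ContFiresSeq M σ L) (h' : N.ContFiresSeq L σ' M') :
    N.ContFiresSeq M (σ ++ σ') M' := by
  induction σ generalizing M with
  | nil => cases h; exact h'
  | cons t τ ih =>
    obtain ⟨K, h1, h2⟩ := h
    exact ⟨K, h1, ih h2⟩

theorem ContFiresSeq.reversed {N : PetriNet P T} {σ : List (ℚ≥0 × T)} {M M' : P → ℚ≥0}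
    (h : N.ContFiresSeq M σ M') : N.reversed.ContFiresSeq M' σ.reverse M := by
  induction σ generalizing M with
  | nil => exact Eq.symm h
  | cons t τ ih =>
    obtain ⟨K, h1, h2⟩ := h
    rw [List.reverse_cons]
    exact (ih h2).append ⟨M, h1.reversed, rfl⟩

/-- All places that a transition of the list consumes from lie in `S` or are produced to by an
earlier transition of the list. -/
def EnabledFrom (N : PetriNet P T) : Set P → List T → Prop
  | _, [] => True
  | S, t :: l => (∀ p, 0 < N.pre p t → p ∈ S) ∧ N.EnabledFrom (S ∪ {p | 0 < N.post p t}) l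

end PetriNet

/-! ### Parikh images and supports -/

section Parikh

variable {T : Type*}

open Classical in
theorem contParikh_cons (x : ℚ≥0 × T) (σ : List (ℚ≥0 × T)) (t : T) :
    contParikh (x :: σ) t = (if x.2 = t then x.1 else 0) + contParikh σ t := by
  simp [contParikh]

theorem mem_contSupp_cons (x : ℚ≥0 × T) (σ : List (ℚ≥0 × T)) (t : T) :
    t ∈ contSupp (x :: σ) ↔ (x.2 = t ∧ x.1 ≠ 0) ∨ t ∈ contSupp σ := by
  simp only [contSupp, Function.mem_support, contParikh_cons]
  split_ifs with h <;> simp [h]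
  tauto

theorem contSupp_reverse (σ : List (ℚ≥0 × T)) : contSupp σ.reverse = contSupp σ := by
  have : contParikh σ.reverse = contParikh σ := by
    funext t
    simp [contParikh, List.map_reverse, List.sum_reverse]
  rw [contSupp, this, contSupp]

end Parikh

/-! ### The marking equation and enabled orders of the support -/

namespace PetriNet

variable {P T : Type*}

theorem ContFiresSeq.marking_eq [Fintype T] {N : PetriNet P T} {σ : List (ℚ≥0 × T)}
    {M M' : P → ℚ≥0} (h : N.ContFiresSeq M σ M') (p : P) :
    (M' p : ℚ) = M p + ∑ t, (contParikh σ t : ℚ) * N.incidence p t := by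
  classical
  induction σ generalizing M with
  | nil => cases h; simp [contParikh]
  | cons x σ ih =>
    obtain ⟨L, h1, h2⟩ := h
    rw [ih h2, (h1 p).2]
    simp only [contParikh_cons]
    simp only [NNRat.cast_add]
    simp only [add_mul, Finset.sum_add_distrib]
    have : ∑ t, (((if x.2 = t then x.1 else 0 : ℚ≥0)) : ℚ) * (N.incidence p t : ℚ)
        = x.1 * N.incidence p x.2 := by
      rw [Finset.sum_eq_single x.2] <;> simp +contextual [eq_comm]
    rw [← this]
    ring

/-- Induction along `σ`: `S` over-approximates the marked places and `F` collects the transitions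
already listed. Firings with factor zero or of a transition in `F` mark no place outside `S`, so
they are skipped; any other transition is appended to the order. -/
theorem ContFiresSeq.exists_enabledFrom {N : PetriNet P T} {σ : List (ℚ≥0 × T)}
    {L M' : P → ℚ≥0} (h : N.ContFiresSeq L σ M') (S : Set P) (F : Set T)
    (hS : ∀ p, 0 < L p → p ∈ S) (hF : ∀ t ∈ F, ∀ p, 0 < N.post p t → p ∈ S) :
    ∃ l : List T, l.Nodup ∧ (∀ t, t ∈ l ↔ t ∉ F ∧ t ∈ contSupp σ) ∧ N.EnabledFrom S l := by
  induction σ generalizing L S F with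
  | nil => exact ⟨[], by simp, by simp [contSupp, contParikh], trivial⟩
  | cons x σ ih =>
    obtain ⟨c, t⟩ := x
    obtain ⟨K, h1, h2⟩ := h
    have hK : ∀ p, 0 < K p → 0 < L p ∨ (c ≠ 0 ∧ 0 < N.post p t) := by
      intro p hp
      by_contra! hcon
      obtain ⟨hL, hc⟩ := hcon
      have hL0 : L p = 0 := le_antisymm hL zero_le
      have hcp : (c : ℚ) * N.post p t = 0 := by
        by_cases h0 : c = 0
        · simp [h0]
        · simp [Nat.le_zero.mp (hc h0)]
      have hKp : (0 : ℚ) < K p := by exact_mod_cast hp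
      have := (h1 p).2
      simp only [incidence, hL0] at this
      push_cast at this
      rw [mul_sub, hcp] at this
      have h3 : (0 : ℚ) ≤ c * N.pre p t := by positivity
      linarith
    by_cases hc : c = 0
    · obtain ⟨l, hl1, hl2, hl3⟩ := ih h2 S F
        (fun p hp => (hK p hp).elim (hS p) (fun h => absurd hc h.1)) hF
      exact ⟨l, hl1, fun s => by rw [hl2, mem_contSupp_cons]; simp [hc], hl3⟩
    by_cases ht : t ∈ F
    · obtain ⟨l, hl1, hl2, hl3⟩ := ih h2 S F
        (fun p hp => (hK p hp).elim (hS p) (fun h => hF t ht p h.2)) hF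
      refine ⟨l, hl1, fun s => ?_, hl3⟩
      rw [hl2, mem_contSupp_cons]
      constructor
      · tauto
      · rintro ⟨h3, ⟨h4, -⟩ | h4⟩
        · exact absurd (h4 ▸ ht) h3
        · exact ⟨h3, h4⟩
    · obtain ⟨l, hl1, hl2, hl3⟩ := ih h2 (S ∪ {p | 0 < N.post p t}) (insert t F)
        (fun p hp => (hK p hp).elim (fun h => Or.inl (hS p h)) (fun h => Or.inr h.2))
        (by
          rintro s (rfl | hs) p hp
          · exact Or.inr hp
          · exact Or.inl (hF s hs p hp))
      refine ⟨t :: l, ?_, fun s => ?_, ?_, hl3⟩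
      · rw [List.nodup_cons]
        exact ⟨fun h => ((hl2 t).1 h).1 (Set.mem_insert _ _), hl1⟩
      · rw [List.mem_cons, hl2, mem_contSupp_cons, Set.mem_insert_iff]
        by_cases hst : s = t
        · subst hst; simp [ht, hc]
        · simp [hst, Ne.symm hst]
      · intro p hp
        apply hS
        refine lt_of_lt_of_le ?_ (h1 p).1
        have : (0 : ℚ≥0) < N.pre p t := by exact_mod_cast hp
        exact mul_pos (pos_iff_ne_zero.2 hc) this

theorem sum_map_incidence [Fintype T] [DecidableEq T] (N : PetriNet P T) (τ : List T) (p : P) :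
    (τ.map (N.incidence p)).sum = ∑ t, (τ.count t : ℤ) * N.incidence p t := by
  rw [Finset.sum_list_map_count]
  simp only [nsmul_eq_mul]
  apply Finset.sum_subset (Finset.subset_univ _)
  intro t _ ht
  rw [List.mem_toFinset] at ht
  simp [List.count_eq_zero_of_not_mem ht]

/-! ### From a solution of the marking equation to a firing sequence -/

section Weight

variable [Fintype P] [Fintype T]

theorem pre_le_weight (N : PetriNet P T) (p : P) (t : T) : N.pre p t ≤ N.weight :=
  (le_max_left _ _).trans <|
    (Finset.le_sup (f := fun t : T => max (N.pre p t) (N.post p t)) (Finset.mem_univ t)).trans <|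
      Finset.le_sup (f := fun p : P => Finset.univ.sup fun t : T => max (N.pre p t) (N.post p t))
        (Finset.mem_univ p)

theorem post_le_weight (N : PetriNet P T) (p : P) (t : T) : N.post p t ≤ N.weight :=
  (le_max_right _ _).trans <|
    (Finset.le_sup (f := fun t : T => max (N.pre p t) (N.post p t)) (Finset.mem_univ t)).trans <|
      Finset.le_sup (f := fun p : P => Finset.univ.sup fun t : T => max (N.pre p t) (N.post p t))
        (Finset.mem_univ p)

theorem weight_reversed (N : PetriNet P T) : N.reversed.weight = N.weight := by
  simp [weight, reversed, max_comm]

theorem abs_incidence_le_weight (N : PetriNet P T) (p : P) (t : T) :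
    |N.incidence p t| ≤ N.weight := by
  have h1 := N.pre_le_weight p t
  have h2 := N.post_le_weight p t
  simp only [incidence]
  rw [abs_le]
  constructor <;> omega

/-- A firing sequence is enabled if all places it consumes from carry enough tokens. -/
theorem exists_firesSeq (N : PetriNet P T) (τ : List T) (M : P → ℕ)
    (h : ∀ p, (∀ t ∈ τ, N.pre p t = 0) ∨ N.weight * τ.length ≤ M p) :
    ∃ M' : P → ℕ, N.FiresSeq M τ M' ∧
      ∀ p, (M' p : ℤ) = M p + (τ.map (N.incidence p)).sum := by
  induction τ generalizing M with
  | nil => exact ⟨M, rfl, by simp⟩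
  | cons t τ ih =>
    have hpre : ∀ p, N.pre p t ≤ M p := by
      intro p
      rcases h p with h | h
      · simp [h t]
      · have := N.pre_le_weight p t
        rw [List.length_cons] at h
        nlinarith
    obtain ⟨M', h1, h2⟩ := ih (fun p => M p - N.pre p t + N.post p t) (by
      intro p
      rcases h p with h | h
      · exact Or.inl fun s hs => h s (by simp [hs])
      · right
        have := N.pre_le_weight p t
        rw [List.length_cons, mul_add, mul_one] at h
        omega)
    have hL : ∀ p, ((M p - N.pre p t + N.post p t : ℕ) : ℤ) = M p + N.incidence p t := by
      intro p
      have := hpre p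
      simp only [incidence]
      omega
    refine ⟨M', ⟨_, fun p => ⟨hpre p, hL p⟩, h1⟩, fun p => ?_⟩
    rw [h2, hL, List.map_cons, List.sum_cons]
    ring

/-- A firing sequence can be repeated if the places it consumes from carry enough tokens before the
first and after the last repetition. -/
theorem firesSeq_repeat (N : PetriNet P T) (τ : List T) (g : ℕ) (M M' : P → ℕ)
    (hM : ∀ p, (M' p : ℤ) = M p + g * (τ.map (N.incidence p)).sum)
    (h : ∀ p, (∀ t ∈ τ, N.pre p t = 0) ∨
      N.weight * τ.length ≤ M p ∧ N.weight * τ.length ≤ M' p) :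
    N.FiresSeq M (List.replicate g τ).flatten M' := by
  induction g generalizing M with
  | zero =>
    have : M = M' := by
      funext p
      have := hM p
      push_cast at this
      omega
    exact this
  | succ g ih =>
    obtain ⟨L, h1, h2⟩ := N.exists_firesSeq τ M fun p => (h p).imp id And.left
    rw [List.replicate_succ, List.flatten_cons]
    refine h1.append (ih L (fun p => ?_) fun p => (h p).imp id ?_)
    · rw [hM, h2]; push_cast; ring
    · rintro ⟨h3, h4⟩
      refine ⟨?_, h4⟩
      have h5 := hM p
      have h6 := h2 p
      push_cast at h5
      -- `L p` lies between `M p` and `M' p`: it is at least `M p` if one repetition has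
      -- non-negative effect on `p`, and at least `M' p` otherwise.
      rcases le_total 0 (τ.map (N.incidence p)).sum with h0 | h0
      · omega
      · have : (g : ℤ) * (τ.map (N.incidence p)).sum ≤ 0 :=
          mul_nonpos_of_nonneg_of_nonpos (by positivity) h0
        have : (M' p : ℤ) ≤ L p := by rw [h5, h6]; linarith
        omega

/-- Firing the transitions of an enabled list with decreasing multiplicities marks all the places
that the list touches. -/
theorem EnabledFrom.exists_firesSeq [DecidableEq T] {N : PetriNet P T} (hw : 1 ≤ N.weight) (c : ℕ)
    (l : List T) (S : Set P) (hl : N.EnabledFrom S l) (L : P → ℕ)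
    (hL : ∀ p ∈ S, c * (N.weight + 1) ^ l.length ≤ L p) :
    ∃ (τ : List T) (L' : P → ℕ) (u : T → ℕ), N.FiresSeq L τ L' ∧
      (∀ p, (L' p : ℤ) = L p + c * ∑ t, (u t : ℤ) * N.incidence p t) ∧
      (∀ t, τ.count t = c * u t) ∧
      (∀ t, u t ≤ (N.weight + 1) ^ l.length) ∧ (∀ t, t ∉ l → u t = 0) ∧
      ∀ p, (p ∈ S ∨ ∃ t ∈ l, 0 < N.pre p t ∨ 0 < N.post p t) → c ≤ L' p := by
  induction l generalizing S L with
  | nil =>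
    refine ⟨[], L, 0, rfl, by simp, by simp, by simp, by simp, ?_⟩
    intro p hp
    simpa using hL p (by simpa using hp)
  | cons t l ih =>
    obtain ⟨hl1, hl2⟩ := hl
    set x := (N.weight + 1) ^ l.length with hx
    have hpow : (N.weight + 1) ^ (t :: l).length = N.weight * x + x := by
      rw [List.length_cons, pow_succ, hx]; ring
    rw [hpow] at hL
    -- Firing `t` exactly `c * x` times costs a place of `S` at most `c * w * x` tokens, so `c * x`
    -- of its `c * (w + 1) * x` tokens are left. Each output place outside `S` receives at least `c
    -- * x`, which is what the rest of the list needs.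
    obtain ⟨K, hK1, hK2⟩ := N.exists_firesSeq (List.replicate (c * x) t) L (by
      intro p
      by_cases h0 : N.pre p t = 0
      · left
        intro s hs
        rw [List.eq_of_mem_replicate hs, h0]
      · right
        have := hL p (hl1 p (Nat.pos_of_ne_zero h0))
        rw [List.length_replicate]
        nlinarith)
    have hK3 : ∀ p, (K p : ℤ) = L p + (c * x : ℕ) * N.incidence p t := by
      intro p; rw [hK2]; simp
    obtain ⟨τ, L', u, h1, h2, h3, h4, h5, h6⟩ := ih _ hl2 K (by
      intro p hp
      have hK := hK3 p
      simp only [incidence] at hK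
      by_cases hpS : p ∈ S
      · have h7 := hL p hpS
        have h8 : c * x * N.pre p t ≤ c * x * N.weight :=
          Nat.mul_le_mul_left _ (N.pre_le_weight p t)
        zify at h7 h8 ⊢
        push_cast at hK
        have : (0 : ℤ) ≤ c * x * N.post p t := by positivity
        nlinarith
      · have hpost : 0 < N.post p t := hp.resolve_left hpS
        have hpre : N.pre p t = 0 := by
          by_contra h0
          exact hpS (hl1 p (Nat.pos_of_ne_zero h0))
        rw [hpre] at hK
        have h8 : c * x * 1 ≤ c * x * N.post p t := Nat.mul_le_mul_left _ hpost
        zify at h8 ⊢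
        push_cast at hK
        have : (0 : ℤ) ≤ L p := by positivity
        linarith)
    refine ⟨List.replicate (c * x) t ++ τ, L', fun s => (if s = t then x else 0) + u s,
      hK1.append h1, fun p => ?_, fun s => ?_, fun s => ?_, fun s hs => ?_, fun p hp => ?_⟩
    · rw [h2, hK3]
      push_cast
      simp only [add_mul, Finset.sum_add_distrib, ite_mul, zero_mul, Finset.sum_ite_eq',
        Finset.mem_univ, if_true]
      ring
    · rw [List.count_append, h3, List.count_replicate]
      simp only [beq_iff_eq, @eq_comm _ t s]
      split_ifs <;> ring
    · rw [hpow]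
      have := h4 s
      dsimp only
      split_ifs <;> nlinarith
    · simp only [List.mem_cons, not_or] at hs
      simp [hs.1, h5 s hs.2]
    · apply h6
      rcases hp with hp | ⟨s, hs, hp⟩
      · exact Or.inl (Or.inl hp)
      · rcases List.mem_cons.1 hs with rfl | hs
        · left
          exact hp.imp (hl1 p) id
        · exact Or.inr ⟨s, hs, hp⟩

theorem exists_list_count [DecidableEq T] (z : T → ℕ) : ∃ τ : List T, ∀ t, τ.count t = z t := by
  refine ⟨(∑ t, z t • ({t} : Multiset T)).toList, fun t => ?_⟩
  rw [← Multiset.coe_count, Multiset.coe_toList, Multiset.count_sum']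
  simp [Multiset.count_singleton]

/-- A solution of the marking equation whose support is enabled forwards and backwards becomes a
firing sequence after scaling. -/
theorem exists_firesSeq_smul [DecidableEq T] (N : PetriNet P T) (hw : 1 ≤ N.weight)
    (M M' : P → ℕ) (z : T → ℕ) (k m b g : ℕ) (hk : 1 ≤ k)
    (hz : ∀ p, ∑ t, (z t : ℤ) * N.incidence p t = k * ((M' p : ℤ) - M p))
    (l l' : List T) (hl : N.EnabledFrom {p | 0 < M p} l)
    (hl' : N.reversed.EnabledFrom {p | 0 < M' p} l')
    (hlz : ∀ t, t ∈ l ↔ z t ≠ 0) (hlz' : ∀ t, t ∈ l' ↔ z t ≠ 0)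
    (hlm : l.length ≤ m) (hlm' : l'.length ≤ m)
    (hb : 2 * (N.weight + 1) ^ m ≤ b) (hg : N.weight * (b * ∑ t, z t) ≤ g) :
    ∃ τ : List T, (∀ t, τ.count t = g * b * z t) ∧
      N.FiresSeq ((g * b * k) • M) τ ((g * b * k) • M') := by
  have hpow : ∀ {i}, i ≤ m → (N.weight + 1) ^ i ≤ (N.weight + 1) ^ m := fun h =>
    Nat.pow_le_pow_right (by omega) h
  have hstart : ∀ (i x : ℕ), i ≤ m → 0 < x → g * (N.weight + 1) ^ i ≤ g * b * k * x := by
    intro i x hi hx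
    have h1 : (N.weight + 1) ^ i ≤ b := (hpow hi).trans (by omega)
    calc g * (N.weight + 1) ^ i ≤ g * b := Nat.mul_le_mul_left _ h1
      _ ≤ g * b * k := Nat.le_mul_of_pos_right _ hk
      _ ≤ g * b * k * x := Nat.le_mul_of_pos_right _ hx
  obtain ⟨τ₁, L₁, u, h1, h2, h3, h4, h5, h6⟩ := hl.exists_firesSeq hw g l _ ((g * b * k) • M)
    (fun p hp => hstart _ _ hlm hp)
  obtain ⟨τ₂, L₂, v, h1', h2', h3', h4', h5', h6'⟩ :=
    hl'.exists_firesSeq (by rwa [weight_reversed]) g l' _ ((g * b * k) • M')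
    (fun p hp => by rw [weight_reversed]; exact hstart _ _ hlm' hp)
  rw [weight_reversed] at h4'
  -- On the support `z t ≥ 1`, and `u t`, `v t` are at most `(w + 1) ^ m`; off the support all three
  -- vanish.
  have huv : ∀ t, u t + v t ≤ b * z t := by
    intro t
    by_cases h0 : z t = 0
    · rw [h5 t (by simp [hlz, h0]), h5' t (by simp [hlz', h0])]
      simp
    · have := (h4 t).trans (hpow hlm)
      have := (h4' t).trans (hpow hlm')
      have : b ≤ b * z t := Nat.le_mul_of_pos_right _ (Nat.pos_of_ne_zero h0)
      omega
  -- Since both outer phases have multiplicities divisible by `g`, the remainder is `g` copies of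
  -- this one word, in any order.
  obtain ⟨τ, hτ⟩ := exists_list_count fun t => b * z t - (u t + v t)
  have hτ' : ∀ t, (τ.count t : ℤ) = b * z t - u t - v t := by
    intro t
    rw [hτ]
    have := huv t
    push_cast [Nat.cast_sub this]
    ring
  have hlen : N.weight * τ.length ≤ g := by
    refine le_trans (Nat.mul_le_mul_left _ ?_) hg
    have : τ.length = ∑ t, τ.count t := by
      rw [← Multiset.coe_card, ← Multiset.sum_count_eq_card (s := Finset.univ)] <;> simp
    rw [this, Finset.mul_sum]
    exact Finset.sum_le_sum fun t _ => by rw [hτ]; omega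
  have hmid : N.FiresSeq L₁ (List.replicate g τ).flatten L₂ := by
    refine N.firesSeq_repeat τ g L₁ L₂ (fun p => ?_) fun p => ?_
    · rw [h2, h2', sum_map_incidence]
      simp only [hτ', incidence_reversed, sub_mul, Finset.sum_sub_distrib, mul_neg,
        Finset.sum_neg_distrib, mul_assoc, ← Finset.mul_sum, hz, Pi.smul_apply, smul_eq_mul]
      push_cast
      ring
    · by_cases h0 : ∀ t ∈ τ, N.pre p t = 0
      · exact Or.inl h0
      · right
        push Not at h0
        obtain ⟨t, ht, hp⟩ := h0
        have hzt : z t ≠ 0 := by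
          intro h0
          have := List.count_pos_iff.2 ht
          rw [hτ, h0] at this
          omega
        exact ⟨hlen.trans (h6 p (Or.inr ⟨t, (hlz t).2 hzt, Or.inl (Nat.pos_of_ne_zero hp)⟩)),
          hlen.trans (h6' p (Or.inr ⟨t, (hlz' t).2 hzt, Or.inr (Nat.pos_of_ne_zero hp)⟩))⟩
  refine ⟨τ₁ ++ ((List.replicate g τ).flatten ++ τ₂.reverse), fun t => ?_,
    h1.append (hmid.append h1'.reversed)⟩
  have : ((List.replicate g τ).flatten.count t) = g * τ.count t := by
    simp [List.count_flatten]
  rw [List.count_append, List.count_append, this, List.count_reverse, h3, h3']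
  zify
  rw [hτ']
  ring

end Weight

end PetriNet

/-! ### Small natural kernel vectors with prescribed support -/

section Kernel

open Matrix

variable {P E : Type*} [Fintype E]

/-- A non-negative kernel vector can be replaced by one whose support carries no kernel vector
vanishing at a given coordinate. -/
theorem exists_nonneg_kernel_minimal (B : Matrix P E ℚ) (e : E) (x : E → ℚ)
    (hx : ∀ i, 0 ≤ x i) (hBx : B *ᵥ x = 0) (he : 0 < x e) :
    ∃ x' : E → ℚ, (∀ i, 0 ≤ x' i) ∧ B *ᵥ x' = 0 ∧ 0 < x' e ∧ (∀ i, x i = 0 → x' i = 0) ∧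
      ∀ y : E → ℚ, B *ᵥ y = 0 → (∀ i, x' i = 0 → y i = 0) → y e = 0 → y = 0 := by
  classical
  induction hn : (Finset.univ.filter fun i => x i ≠ 0).card using Nat.strong_induction_on
    generalizing x with
  | _ n ih =>
  by_cases hmin : ∀ y : E → ℚ, B *ᵥ y = 0 → (∀ i, x i = 0 → y i = 0) → y e = 0 → y = 0
  · exact ⟨x, hx, hBx, he, fun _ h => h, hmin⟩
  have hpos : ∃ y : E → ℚ, B *ᵥ y = 0 ∧ (∀ i, x i = 0 → y i = 0) ∧ y e = 0 ∧ ∃ i, 0 < y i := by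
    push Not at hmin
    obtain ⟨y, h1, h2, h3, h4⟩ := hmin
    obtain ⟨i, hi⟩ := Function.ne_iff.1 h4
    rcases lt_or_gt_of_ne hi with hi | hi
    · refine ⟨-y, by rw [mulVec_neg, h1, neg_zero], fun i h => by simp [h2 i h], by simp [h3], i, ?_⟩
      simpa using hi
    · exact ⟨y, h1, h2, h3, i, hi⟩
  obtain ⟨y, h1, h2, h3, i₀, hi₀⟩ := hpos
  obtain ⟨j, hj, hjmin⟩ := Finset.exists_min_image (Finset.univ.filter fun i => 0 < y i)
    (fun i => x i / y i) ⟨i₀, by simpa using hi₀⟩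
  have hyj : 0 < y j := by simpa using hj
  -- The largest step along `-y` that keeps `x` non-negative: it kills coordinate `j`, and keeps `x
  -- e` because `y e = 0`.
  set θ := x j / y j with hθ
  have hθ0 : 0 ≤ θ := div_nonneg (hx j) hyj.le
  have hsub : ∀ i, x i = 0 → x i - θ * y i = 0 := fun i h => by simp [h, h2 i h]
  have hlt : (Finset.univ.filter fun i => x i - θ * y i ≠ 0).card < n := by
    rw [← hn]
    apply Finset.card_lt_card
    rw [Finset.ssubset_iff_of_subset]
    · refine ⟨j, ?_, ?_⟩
      · have : x j ≠ 0 := fun h => hyj.ne' (h2 j h)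
        simpa using this
      · simp [hθ, hyj.ne']
    · intro i hi
      simp only [Finset.mem_filter, Finset.mem_univ, true_and] at hi ⊢
      exact fun h => hi (hsub i h)
  have hnonneg : ∀ i, 0 ≤ x i - θ * y i := by
    intro i
    rcases lt_or_ge 0 (y i) with hi | hi
    · have := hjmin i (by simpa using hi)
      rw [le_div_iff₀ hi] at this
      linarith
    · have := mul_nonpos_of_nonneg_of_nonpos hθ0 hi
      have := hx i
      linarith
  have hker : B *ᵥ (fun i => x i - θ * y i) = 0 := by
    have : (fun i => x i - θ * y i) = x - θ • y := rfl
    rw [this, mulVec_sub, mulVec_smul, hBx, h1]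
    simp
  obtain ⟨x', g1, g2, g3, g4, g5⟩ :=
    ih _ hlt (fun i => x i - θ * y i) hnonneg hker (by simpa [h3] using he) rfl
  exact ⟨x', g1, g2, g3, fun i h => g4 i (hsub i h), g5⟩

theorem exists_common_denominator {E : Type*} [Fintype E] (y : E → ℚ) (hy : ∀ i, 0 ≤ y i) :
    ∃ D : ℕ, 0 < D ∧ ∃ Y : E → ℕ, ∀ i, (D : ℚ) * y i = Y i := by
  classical
  refine ⟨∏ i, (y i).den, Finset.prod_pos fun i _ => (y i).pos,
    fun i => (∏ j ∈ Finset.univ.erase i, (y j).den) * (y i).num.toNat, fun i => ?_⟩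
  rw [← Finset.mul_prod_erase _ _ (Finset.mem_univ i)]
  have h1 : (((y i).num.toNat : ℤ) : ℚ) = (y i).num := by
    rw [Int.toNat_of_nonneg (Rat.num_nonneg.2 (hy i))]
  have h2 : ((y i).den : ℚ) * y i = (y i).num := Rat.den_mul_eq_num (y i)
  push_cast at h1 ⊢
  rw [h1, ← h2]
  ring

theorem abs_det_le_factorial {n : Type*} [Fintype n] [DecidableEq n] (A : Matrix n n ℤ) (X d : ℕ)
    (hX : 1 ≤ X) (hd : Fintype.card n ≤ d) (hA : ∀ i j, |A i j| ≤ X) :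
    |A.det| ≤ (d.factorial * X ^ d : ℕ) := by
  have h := Matrix.det_le (A := A) (abv := AbsoluteValue.abs) (x := (X : ℤ)) (fun i j => hA i j)
  rw [nsmul_eq_mul] at h
  refine le_trans h ?_
  have : (Fintype.card n).factorial * X ^ Fintype.card n ≤ d.factorial * X ^ d :=
    Nat.mul_le_mul (Nat.factorial_le hd) (Nat.pow_le_pow_right hX hd)
  exact_mod_cast this

/-- Take a kernel vector `y` minimal in the sense of `exists_nonneg_kernel_minimal`. The columns `C`
of its support without `e` are independent, so the Gram matrix `Cᵀ * C` is nonsingular and `y` is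
determined up to scale by the normal equations. Cramer's rule then gives integer entries bounded by
determinants; the Gram matrix makes the choice of a square submatrix unnecessary. -/
theorem exists_nat_kernel_of_pos [Fintype P] (B : Matrix P E ℤ) (W : ℕ) (hB : ∀ p i, |B p i| ≤ W) (e : E)
    (x : E → ℚ) (hx : ∀ i, 0 ≤ x i) (hBx : (B.map (Int.cast : ℤ → ℚ)) *ᵥ x = 0) (he : 0 < x e) :
    ∃ z : E → ℕ, (∀ p, ∑ i, B p i * (z i : ℤ) = 0) ∧ 0 < z e ∧ (∀ i, x i = 0 → z i = 0) ∧
      ∀ i, z i ≤ (Fintype.card E).factorial *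
        (Fintype.card P * W ^ 2 + 1) ^ Fintype.card E := by
  classical
  obtain ⟨y, h1, h2, h3, h4, h5⟩ := exists_nonneg_kernel_minimal _ e x hx hBx he
  let S := {i : E // y i ≠ 0 ∧ i ≠ e}
  let C : Matrix P S ℤ := fun p i => B p i.1
  let c : P → ℤ := fun p => - B p e
  let G : Matrix S S ℤ := Cᵀ * C
  let r : S → ℤ := Cᵀ *ᵥ c
  -- The summand `1` makes `X ≥ 1`, so that `X ^ Fintype.card S ≤ X ^ Fintype.card E`.
  set X := Fintype.card P * W ^ 2 + 1 with hX
  have hprod : ∀ p i j, |B p i * B p j| ≤ (W : ℤ) ^ 2 := by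
    intro p i j
    rw [abs_mul, sq]
    exact mul_le_mul (hB p i) (hB p j) (abs_nonneg _) (by positivity)
  have hsum : ∀ i j, |∑ p, B p i * B p j| ≤ X := by
    intro i j
    refine (Finset.abs_sum_le_sum_abs _ _).trans ((Finset.sum_le_sum fun p _ => hprod p i j).trans ?_)
    rw [Finset.sum_const, nsmul_eq_mul, hX, Finset.card_univ]
    push_cast
    linarith
  have hcard : Fintype.card S ≤ Fintype.card E := Fintype.card_subtype_le _
  have hGdet : |G.det| ≤ ((Fintype.card E).factorial * X ^ Fintype.card E : ℕ) :=
    abs_det_le_factorial G X _ (by omega) hcard fun i j => hsum i.1 j.1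
  have hcramer : ∀ i, |G.cramer r i| ≤ ((Fintype.card E).factorial * X ^ Fintype.card E : ℕ) := by
    intro i
    rw [cramer_apply]
    refine abs_det_le_factorial _ X _ (by omega) hcard fun j l => ?_
    rw [updateCol_apply]
    split_ifs
    · have : r j = -∑ p, B p j.1 * B p e := by
        simp [r, C, c, mulVec, dotProduct]
        rfl
      rw [this, abs_neg]
      exact hsum _ _
    · exact hsum _ _
  have hsplit : ∀ (y' : E → ℤ), (∀ i, y i = 0 → y' i = 0) → ∀ p,
      ∑ i, B p i * y' i = B p e * y' e + ∑ i : S, B p i.1 * y' i.1 := by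
    intro y' hy' p
    rw [← Finset.add_sum_erase _ _ (Finset.mem_univ e)]
    congr 1
    rw [← Finset.sum_subtype (Finset.univ.filter fun i => y i ≠ 0 ∧ i ≠ e) (by simp)
      (fun i => B p i * y' i)]
    symm
    apply Finset.sum_subset
    · intro i
      simp
    · intro i hi hi'
      simp only [Finset.mem_erase, Finset.mem_univ, Finset.mem_filter, true_and, and_true,
        not_and_or, not_not] at hi hi'
      rw [hy' i (hi'.resolve_right hi), mul_zero]
  have hdet : G.det ≠ 0 := by
    intro h0
    obtain ⟨v, hv0, hv⟩ := exists_mulVec_eq_zero_iff.2 h0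
    apply hv0
    have hCv : C *ᵥ v = 0 := by
      -- `G v = 0` gives `(C v) ⬝ (C v) = 0`, hence `C v = 0`.
      rw [← dotProduct_self_eq_zero, dotProduct_mulVec, ← mulVec_transpose, mulVec_mulVec, hv,
        zero_dotProduct]
    let y' : E → ℤ := fun i => if h : y i ≠ 0 ∧ i ≠ e then v ⟨i, h⟩ else 0
    have hy' : ∀ i, y i = 0 → y' i = 0 := fun i hi => dif_neg (by simp [hi])
    have hy'S : ∀ i : S, y' i.1 = v i := fun i => dif_pos i.2
    have hy'e : y' e = 0 := dif_neg (by simp)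
    have := h5 (fun i => (y' i : ℚ)) (by
      funext p
      have h6 := hsplit y' hy' p
      simp only [hy'S, hy'e, mul_zero, zero_add] at h6
      have h7 : ∑ i : S, B p i.1 * v i = 0 := congrFun hCv p
      rw [h7] at h6
      have : ((∑ i, B p i * y' i : ℤ) : ℚ) = 0 := by rw [h6]; simp
      simpa [mulVec, dotProduct] using this) (fun i hi => by simp [hy' i hi]) (by simp [hy'e])
    funext i
    have h6 := congrFun this i.1
    simpa [hy'S] using h6
  obtain ⟨D, hD, Y, hY⟩ := exists_common_denominator y h1
  have hY0 : ∀ i, y i = 0 → (Y i : ℤ) = 0 := by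
    intro i hi
    have := hY i
    rw [hi, mul_zero] at this
    exact_mod_cast this.symm
  have hYe : 0 < Y e := by
    have : (0 : ℚ) < Y e := by rw [← hY]; positivity
    exact_mod_cast this
  have hBY : ∀ p, ∑ i, B p i * (Y i : ℤ) = 0 := by
    intro p
    have h6 : ∑ i, (B p i : ℚ) * y i = 0 := congrFun h2 p
    have : ((∑ i, B p i * (Y i : ℤ) : ℤ) : ℚ) = 0 := by
      push_cast
      simp only [← hY, mul_left_comm _ (D : ℚ), ← Finset.mul_sum, h6, mul_zero]
    exact_mod_cast this
  let v : S → ℤ := fun i => Y i.1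
  have hCv : C *ᵥ v = (Y e : ℤ) • c := by
    funext p
    have h6 := hsplit (fun i => Y i) hY0 p
    rw [hBY] at h6
    change ∑ i : S, B p i.1 * (Y i.1 : ℤ) = Y e * -B p e
    linarith
  have hkey : ∀ i : S, G.det * Y i.1 = Y e * G.cramer r i := by
    have h6 : G *ᵥ v = (Y e : ℤ) • r := by
      change (Cᵀ * C) *ᵥ v = _
      rw [← mulVec_mulVec, hCv, mulVec_smul]
    have h7 : G.det • v = (Y e : ℤ) • G.cramer r := by
      rw [cramer_eq_adjugate_mulVec, ← mulVec_smul, ← h6, mulVec_mulVec, adjugate_mul,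
        smul_mulVec, one_mulVec]
    exact fun i => congrFun h7 i
  -- Absolute values suffice: `Y` is non-negative, so `hkey` makes `z` the multiple of `Y` by
  -- `|G.det| / Y e`.
  let z : E → ℕ := fun i =>
    if i = e then G.det.natAbs else if h : y i ≠ 0 ∧ i ≠ e then (G.cramer r ⟨i, h⟩).natAbs else 0
  have hzY : ∀ i, (Y e : ℤ) * z i = |G.det| * Y i := by
    intro i
    dsimp only [z]
    split_ifs with h6 h7
    · rw [h6, Int.natCast_natAbs, mul_comm]
    · have := congrArg abs (hkey ⟨i, h7⟩)
      rw [abs_mul, abs_mul, Nat.abs_cast, Nat.abs_cast] at this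
      rw [Int.natCast_natAbs, this]
    · have : y i = 0 := by tauto
      rw [hY0 i this]
      simp
  refine ⟨z, fun p => ?_, ?_, fun i hi => ?_, fun i => ?_⟩
  · have : (Y e : ℤ) * ∑ i, B p i * (z i : ℤ) = 0 := by
      simp only [Finset.mul_sum, mul_left_comm (Y e : ℤ), hzY]
      simp only [mul_left_comm _ |G.det|, ← Finset.mul_sum, hBY, mul_zero]
    exact (mul_eq_zero.1 this).resolve_left (by omega)
  · simpa [z] using hdet
  · have := hzY i
    rw [hY0 i (h4 i hi), mul_zero] at this
    have := (mul_eq_zero.1 this).resolve_left (by omega)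
    exact_mod_cast this
  · dsimp only [z]
    split_ifs
    · zify; exact_mod_cast hGdet
    · zify; exact_mod_cast hcramer _
    · exact Nat.zero_le _

/-- A positive rational kernel vector of an integer matrix can be replaced by a small natural one
with the same support. -/
theorem exists_nat_kernel [Fintype P] (B : Matrix P E ℤ) (W : ℕ) (hB : ∀ p i, |B p i| ≤ W)
    (x : E → ℚ) (hx : ∀ i, 0 ≤ x i) (hBx : (B.map (Int.cast : ℤ → ℚ)) *ᵥ x = 0) :
    ∃ z : E → ℕ, (∀ p, ∑ i, B p i * (z i : ℤ) = 0) ∧ (∀ i, z i = 0 ↔ x i = 0) ∧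
      ∀ i, z i ≤ Fintype.card E * ((Fintype.card E).factorial *
        (Fintype.card P * W ^ 2 + 1) ^ Fintype.card E) := by
  have h : ∀ e : E, ∃ z : E → ℕ, (∀ p, ∑ i, B p i * (z i : ℤ) = 0) ∧ (x e ≠ 0 → 0 < z e) ∧
      (∀ i, x i = 0 → z i = 0) ∧ ∀ i, z i ≤ (Fintype.card E).factorial *
        (Fintype.card P * W ^ 2 + 1) ^ Fintype.card E := by
    intro e
    by_cases he : x e = 0
    · exact ⟨0, by simp, fun h => absurd he h, by simp, by simp⟩
    · obtain ⟨z, h1, h2, h3⟩ :=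
        exists_nat_kernel_of_pos B W hB e x hx hBx (lt_of_le_of_ne (hx e) (Ne.symm he))
      exact ⟨z, h1, fun _ => h2, h3⟩
  choose z h1 h2 h3 h4 using h
  -- Adding one vector per coordinate `e` gives exactly the support of `x`, as nothing cancels; this
  -- costs the factor `Fintype.card E`.
  refine ⟨fun i => ∑ e, z e i, fun p => ?_, fun i => ?_, fun i => ?_⟩
  · push_cast
    simp only [Finset.mul_sum]
    rw [Finset.sum_comm]
    simp [h1]
  · rw [Finset.sum_eq_zero_iff]
    constructor
    · intro h
      by_contra h0
      exact (h2 i h0).ne' (h i (Finset.mem_univ i))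
    · exact fun h e _ => h3 e i h
  · exact (Finset.sum_le_card_nsmul _ _ _ fun e _ => h4 e i).trans (by simp)

end Kernel

/-! ### Scaling continuous runs -/

namespace PetriNet

variable {P T : Type*}

theorem ContFiresSeq.exists_enabledFrom_supp {N : PetriNet P T} {M M' : P → ℕ}
    {σ : List (ℚ≥0 × T)} (h : N.ContFiresSeq (toContMarking M) σ (toContMarking M')) :
    ∃ l : List T, (∀ t, t ∈ l ↔ t ∈ contSupp σ) ∧ l.length = (contSupp σ).ncard ∧
      N.EnabledFrom {p | 0 < M p} l := by
  classical
  obtain ⟨l, h1, h2, h3⟩ := h.exists_enabledFrom {p | 0 < M p} ∅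
    (fun p hp => by simpa [toContMarking] using hp) (by simp)
  have h2' : ∀ t, t ∈ l ↔ t ∈ contSupp σ := by simpa using h2
  refine ⟨l, h2', ?_, h3⟩
  have : contSupp σ = (l.toFinset : Set T) := by
    ext t
    simp [h2']
  rw [this, Set.ncard_coe_finset, List.toFinset_card_of_nodup h1]

theorem mem_contSupp {σ : List (ℚ≥0 × T)} {t : T} : t ∈ contSupp σ ↔ contParikh σ t ≠ 0 :=
  Iff.rfl

variable [Fintype P] [Fintype T]

/-- Scaling with an arbitrary integer solution of the marking equation that has the right
support. -/
theorem ContFiresSeq.exists_firesSeq_smul {N : PetriNet P T} (hw : 1 ≤ N.weight) {M M' : P → ℕ}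
    {σ : List (ℚ≥0 × T)} (h : N.ContFiresSeq (toContMarking M) σ (toContMarking M'))
    (z : T → ℕ) (k b g : ℕ) (hk : 1 ≤ k)
    (hz : ∀ p, ∑ t, (z t : ℤ) * N.incidence p t = k * ((M' p : ℤ) - M p))
    (hzσ : ∀ t, z t = 0 ↔ contParikh σ t = 0)
    (hb : 2 * (N.weight + 1) ^ (contSupp σ).ncard ≤ b) (hg : N.weight * (b * ∑ t, z t) ≤ g)
    (hg0 : 1 ≤ g) :
    ∃ τ : List T, seqSupp τ = contSupp σ ∧
      N.FiresSeq ((g * b * k) • M) τ ((g * b * k) • M') := by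
  classical
  obtain ⟨l, h1, h2, h3⟩ := h.exists_enabledFrom_supp
  obtain ⟨l', h1', h2', h3'⟩ := h.reversed.exists_enabledFrom_supp
  rw [contSupp_reverse] at h1' h2'
  obtain ⟨τ, h4, h5⟩ := N.exists_firesSeq_smul hw M M' z k _ b g hk hz l l' h3 h3'
    (fun t => by rw [h1, mem_contSupp, Ne, Ne, hzσ]) (fun t => by rw [h1', mem_contSupp, Ne, Ne, hzσ])
    h2.le h2'.le hb hg
  refine ⟨τ, ?_, h5⟩
  have hb0 : 1 ≤ b := le_trans (Nat.mul_pos two_pos (by positivity)) hb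
  ext t
  rw [mem_contSupp, Ne, ← hzσ, seqSupp, Set.mem_ofPred_eq, ← List.count_pos_iff, h4,
    Nat.pos_iff_ne_zero]
  simp only [ne_eq, mul_eq_zero]
  omega

/-- The degenerate case left out by `exists_firesSeq_smul`: without arcs every transition is always
enabled and changes nothing, so any listing of the support fires. -/
theorem ContFiresSeq.exists_firesSeq_of_weight_eq_zero {N : PetriNet P T} (hw : N.weight = 0)
    {M M' : P → ℕ} {σ : List (ℚ≥0 × T)}
    (h : N.ContFiresSeq (toContMarking M) σ (toContMarking M')) (n : ℕ) :
    ∃ τ : List T, seqSupp τ = contSupp σ ∧ N.FiresSeq (n • M) τ (n • M') := by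
  have hpre : ∀ p t, N.pre p t = 0 := fun p t => by have := N.pre_le_weight p t; omega
  have hpost : ∀ p t, N.post p t = 0 := fun p t => by have := N.post_le_weight p t; omega
  have hinc : ∀ p t, N.incidence p t = 0 := fun p t => by simp [incidence, hpre, hpost]
  have hM : M' = M := by
    funext p
    have := h.marking_eq p
    simpa [hinc, toContMarking] using this
  obtain ⟨l, h1, -, -⟩ := h.exists_enabledFrom_supp
  refine ⟨l, Set.ext h1, ?_⟩
  obtain ⟨L, h2, h3⟩ := N.exists_firesSeq l (n • M) fun p => Or.inl fun t _ => hpre p t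
  have : L = n • M := by
    funext p
    have := h3 p
    have h0 : N.incidence p = fun _ => 0 := funext (hinc p)
    simp only [h0, List.map_const', List.sum_replicate, smul_zero, add_zero] at this
    exact_mod_cast this
  rw [hM]
  rwa [this] at h2

theorem exists_isLeastDenominator (x : T → ℚ≥0) : ∃ k, IsLeastDenominator x k := by
  classical
  have h : ∃ j : ℕ, 0 < j ∧ ∀ t, ∃ a : ℕ, (j : ℚ≥0) * x t = (a : ℚ≥0) := by
    obtain ⟨D, hD, Y, hY⟩ := exists_common_denominator (fun t => (x t : ℚ)) fun t => (x t).2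
    exact ⟨D, hD, fun t => ⟨Y t, by exact_mod_cast hY t⟩⟩
  exact ⟨Nat.find h, Nat.find_spec h, fun j hj => Nat.find_min' h hj⟩

theorem ContFiresSeq.exists_firesSeq_of_denominator {N : PetriNet P T} {M M' : P → ℕ}
    {σ : List (ℚ≥0 × T)} (h : N.ContFiresSeq (toContMarking M) σ (toContMarking M'))
    (k : ℕ) (hk : 0 < k) (hkσ : ∀ t, ∃ a : ℕ, (k : ℚ≥0) * contParikh σ t = (a : ℚ≥0)) :
    ∃ n : ℕ, (n : ℚ≥0) = 16 * (N.weight : ℚ≥0) *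
        ((N.weight : ℚ≥0) + 1) ^ (2 * (contSupp σ).ncard) *
          (k : ℚ≥0) ^ 2 * vecSize (contParikh σ) ∧
      ∃ τ : List T, seqSupp τ = contSupp σ ∧ N.FiresSeq (n • M) τ (n • M') := by
  choose z hz using hkσ
  have hk' : (k : ℚ≥0) ≠ 0 := by exact_mod_cast hk.ne'
  have hzσ : ∀ t, z t = 0 ↔ contParikh σ t = 0 := by
    intro t
    rw [← Nat.cast_eq_zero (R := ℚ≥0), ← hz, mul_eq_zero]
    simp [hk']
  have hsum : (k : ℚ≥0) * vecSize (contParikh σ) = ((∑ t, z t : ℕ) : ℚ≥0) := by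
    rw [vecSize, Finset.mul_sum]
    push_cast
    exact Finset.sum_congr rfl fun t _ => hz t
  set w := N.weight with hw
  set m := (contSupp σ).ncard with hm
  -- This is `g * b * k` with `b = 2 * (w + 1) ^ m` and `g = 8 * w * (w + 1) ^ m * ∑ t, z t`, where
  -- `∑ t, z t = k ℓ`. The required `g` is only `w * b * ∑ t, z t`, a quarter of it.
  refine ⟨8 * w * (w + 1) ^ m * (∑ t, z t) * (2 * (w + 1) ^ m) * k, ?_, ?_⟩
  · push_cast at hsum ⊢
    rw [← hsum]
    ring
  rcases Nat.eq_zero_or_pos w with hw0 | hw0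
  · exact h.exists_firesSeq_of_weight_eq_zero hw0 _
  rcases Nat.eq_zero_or_pos (∑ t, z t) with hz0 | hz0
  · refine ⟨[], ?_, ?_⟩
    · ext t
      rw [mem_contSupp, Ne, ← hzσ]
      have := (Finset.sum_eq_zero_iff.1 hz0) t (Finset.mem_univ t)
      simp [seqSupp, this]
    · simp [hz0, FiresSeq]
  · refine h.exists_firesSeq_smul hw0 z k _ _ hk (fun p => ?_) hzσ le_rfl ?_ ?_
    · have h1 := h.marking_eq p
      simp only [toContMarking] at h1
      have h2 : ∀ t, (k : ℚ) * contParikh σ t = z t := fun t => by exact_mod_cast hz t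
      have h3 : ((∑ t, (z t : ℤ) * N.incidence p t : ℤ) : ℚ) = k * ((M' p : ℚ) - M p) := by
        push_cast
        simp only [← h2, mul_assoc, ← Finset.mul_sum]
        push_cast at h1
        rw [h1]
        ring
      exact_mod_cast h3
    · rw [← hw]
      have : w * (2 * (w + 1) ^ m * ∑ t, z t) * 1 ≤ w * (2 * (w + 1) ^ m * ∑ t, z t) * 4 :=
        Nat.mul_le_mul_left _ (by norm_num)
      calc _ ≤ _ := by simpa using this
        _ = _ := by ring
    · have : 0 < (w + 1) ^ m := by positivity
      exact Nat.succ_le_of_lt (by positivity)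

/-! ### Bit lengths and the polynomial bound -/

section Size

theorem natSize_pre_le_size (N : PetriNet P T) (p : P) (t : T) :
    Nat.size (N.pre p t) + Nat.size (N.post p t) ≤ N.size := by
  have h1 := Finset.single_le_sum (s := Finset.univ)
    (f := fun p => ∑ t, ((2 * Nat.size (N.pre p t) + 1) + (2 * Nat.size (N.post p t) + 1)))
    (fun _ _ => Nat.zero_le _) (Finset.mem_univ p)
  have h2 := Finset.single_le_sum (s := Finset.univ)
    (f := fun t => ((2 * Nat.size (N.pre p t) + 1) + (2 * Nat.size (N.post p t) + 1)))
    (fun _ _ => Nat.zero_le _) (Finset.mem_univ t)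
  rw [size_eq]
  omega

theorem weight_lt_two_pow_size (N : PetriNet P T) : N.weight < 2 ^ N.size := by
  have h0 : ⊥ < 2 ^ N.size := Nat.pow_pos two_pos
  refine (Finset.sup_lt_iff h0).2 fun p _ => (Finset.sup_lt_iff h0).2 fun t _ => ?_
  have := N.natSize_pre_le_size p t
  exact max_lt (Nat.size_le.1 (by omega)) (Nat.size_le.1 (by omega))

theorem card_places_lt_two_pow_size (N : PetriNet P T) : Fintype.card P < 2 ^ N.size := by
  rw [← Nat.size_le, size_eq]
  omega

/-- Each row of a matrix has one code per transition, so a single place suffices; without places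
only the binary digits of `|T|` would count. -/
theorem card_transitions_le_size [Nonempty P] (N : PetriNet P T) : Fintype.card T ≤ N.size := by
  obtain ⟨p⟩ := ‹Nonempty P›
  have h1 := Finset.single_le_sum (s := Finset.univ)
    (f := fun p => ∑ t, ((2 * Nat.size (N.pre p t) + 1) + (2 * Nat.size (N.post p t) + 1)))
    (fun _ _ => Nat.zero_le _) (Finset.mem_univ p)
  have h2 : Fintype.card T ≤
      ∑ t, ((2 * Nat.size (N.pre p t) + 1) + (2 * Nat.size (N.post p t) + 1)) := by
    rw [Fintype.card_eq_sum_ones]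
    exact Finset.sum_le_sum fun t _ => by omega
  rw [size_eq]
  omega

end Size

/-- An exponential form of the bound on the entries of a small integer solution of the marking
equation. -/
theorem kernel_bound_le (X c d W : ℕ) (hd : d ≤ X + 1) (hc : c ≤ 2 ^ X) (hW : W ≤ 2 ^ (X + 2)) :
    d * (d.factorial * (c * W ^ 2 + 1) ^ d) ≤
      2 ^ ((X + 1) + ((X + 1) * (X + 1) + (3 * X + 5) * (X + 1))) := by
  have hd' : d ≤ 2 ^ (X + 1) := hd.trans Nat.lt_two_pow_self.le
  have h1 : d.factorial ≤ 2 ^ ((X + 1) * (X + 1)) :=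
    calc d.factorial ≤ d ^ d := Nat.factorial_le_pow d
      _ ≤ (2 ^ (X + 1)) ^ d := Nat.pow_le_pow_left hd' d
      _ ≤ (2 ^ (X + 1)) ^ (X + 1) := Nat.pow_le_pow_right (by positivity) hd
      _ = _ := by rw [pow_mul]
  have h2 : c * W ^ 2 + 1 ≤ 2 ^ (3 * X + 5) := by
    have h3 : c * W ^ 2 ≤ 2 ^ X * (2 ^ (X + 2)) ^ 2 :=
      Nat.mul_le_mul hc (Nat.pow_le_pow_left hW 2)
    have h4 : 2 ^ X * (2 ^ (X + 2)) ^ 2 = 2 ^ (3 * X + 4) := by ring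
    have h5 : 1 ≤ 2 ^ (3 * X + 4) := Nat.one_le_two_pow
    have h6 : 2 ^ (3 * X + 5) = 2 * 2 ^ (3 * X + 4) := by ring
    omega
  have h3 : (c * W ^ 2 + 1) ^ d ≤ 2 ^ ((3 * X + 5) * (X + 1)) :=
    calc (c * W ^ 2 + 1) ^ d ≤ (2 ^ (3 * X + 5)) ^ d := Nat.pow_le_pow_left h2 d
      _ ≤ (2 ^ (3 * X + 5)) ^ (X + 1) := Nat.pow_le_pow_right (by positivity) hd
      _ = _ := by rw [pow_mul]
  rw [pow_add, pow_add _ ((X + 1) * (X + 1))]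
  exact Nat.mul_le_mul hd' (Nat.mul_le_mul h1 h3)

/-- The columns are indexed by `Option T`: `none` carries `M - M'` with coefficient `1`, and `some
t` the column of `t` with coefficient `σ⃗ t`. The coordinate `none` of the natural kernel vector
becomes `k`, which is positive because supports agree. -/
theorem ContFiresSeq.exists_small_solution {N : PetriNet P T} {M M' : P → ℕ}
    {σ : List (ℚ≥0 × T)} (h : N.ContFiresSeq (toContMarking M) σ (toContMarking M')) :
    ∃ (z : T → ℕ) (k K : ℕ), 1 ≤ k ∧
      (∀ p, ∑ t, (z t : ℤ) * N.incidence p t = k * ((M' p : ℤ) - M p)) ∧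
      (∀ t, z t = 0 ↔ contParikh σ t = 0) ∧ k ≤ K ∧ (∀ t, z t ≤ K) ∧
      K = (Fintype.card T + 1) * ((Fintype.card T + 1).factorial *
        (Fintype.card P * (N.weight + vecSize M + vecSize M') ^ 2 + 1) ^ (Fintype.card T + 1)) := by
  let B : Matrix P (Option T) ℤ := fun p i => i.elim ((M p : ℤ) - M' p) (N.incidence p)
  let x : Option T → ℚ := fun i => i.elim 1 fun t => contParikh σ t
  have hle : ∀ (L : P → ℕ) p, L p ≤ vecSize L := fun L p =>
    Finset.single_le_sum (fun _ _ => Nat.zero_le _) (Finset.mem_univ p)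
  obtain ⟨y, h1, h2, h3⟩ := exists_nat_kernel B (N.weight + vecSize M + vecSize M')
    (by
      rintro p (_ | t)
      · change |(M p : ℤ) - M' p| ≤ _
        have := hle M p
        have := hle M' p
        rw [abs_le]
        constructor <;> omega
      · have := N.abs_incidence_le_weight p t
        change |N.incidence p t| ≤ _
        omega)
    x (by
      rintro (_ | t)
      · exact zero_le_one
      · exact (contParikh σ t).2)
    (by
      funext p
      have h1 := h.marking_eq p
      simp only [toContMarking] at h1
      push_cast at h1
      change ∑ i, (B p i : ℚ) * x i = 0
      simp only [Fintype.sum_option, B, x, Option.elim]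
      push_cast
      rw [h1]
      simp only [mul_comm]
      ring)
  rw [Fintype.card_option] at h3
  refine ⟨fun t => y (some t), y none, _, ?_, fun p => ?_, fun t => ?_, h3 none,
    fun t => h3 (some t), rfl⟩
  · have : y none ≠ 0 := by simp [h2, x]
    omega
  · have := h1 p
    simp only [Fintype.sum_option, B, Option.elim] at this
    simp only [mul_comm (N.incidence p _)] at this
    linarith
  · simp [h2, x]

theorem ContFiresSeq.exists_small_firesSeq {N : PetriNet P T} {M M' : P → ℕ}
    {σ : List (ℚ≥0 × T)} (h : N.ContFiresSeq (toContMarking M) σ (toContMarking M'))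
    (X : ℕ) (hX : X = N.size * (Nat.size (vecSize M) + Nat.size (vecSize M'))) :
    ∃ n : ℕ, 1 ≤ n ∧
      Nat.size n ≤ 3 * ((X + 1) + ((X + 1) * (X + 1) + (3 * X + 5) * (X + 1))) + 2 * X ^ 2 +
        2 * X + 10 ∧
      ∃ τ : List T, seqSupp τ = contSupp σ ∧ N.FiresSeq (n • M) τ (n • M') := by
  rcases Nat.eq_zero_or_pos N.weight with hw | hw
  · exact ⟨1, le_rfl, by rw [Nat.size_one]; omega, h.exists_firesSeq_of_weight_eq_zero hw 1⟩
  -- If both markings are zero, then `X = 0` and the net is not controlled by `X`; but all multiples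
  -- of the markings coincide, so `n = 1` works with the sequence found for any factor.
  rcases Nat.eq_zero_or_pos (Nat.size (vecSize M) + Nat.size (vecSize M')) with hs | hs
  · obtain ⟨hs1, hs2⟩ := Nat.add_eq_zero_iff.1 hs
    have hzero : ∀ L : P → ℕ, Nat.size (vecSize L) = 0 → L = 0 := by
      intro L hL
      rw [Nat.size_eq_zero] at hL
      funext p
      exact Finset.sum_eq_zero_iff.1 hL p (Finset.mem_univ p)
    obtain ⟨k, hk⟩ := exists_isLeastDenominator (contParikh σ)
    obtain ⟨n, -, τ, h1, h2⟩ := h.exists_firesSeq_of_denominator k hk.1.1 hk.1.2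
    refine ⟨1, le_rfl, by rw [Nat.size_one]; omega, τ, h1, ?_⟩
    rw [hzero M hs1, hzero M' hs2, smul_zero] at h2 ⊢
    exact h2
  -- Positive weight forces a place to exist, which `card_transitions_le_size` needs.
  have hP : Nonempty P := by
    by_contra hP
    rw [not_nonempty_iff] at hP
    simp [weight] at hw
  have hN : N.size ≤ X := by
    rw [hX]
    exact Nat.le_mul_of_pos_right _ hs
  have hT := N.card_transitions_le_size
  have hS1 : 1 ≤ N.size := by rw [size_eq]; omega
  have hsX : Nat.size (vecSize M) + Nat.size (vecSize M') ≤ X := by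
    rw [hX]
    exact Nat.le_mul_of_pos_left _ hS1
  have hpow : ∀ {i}, i ≤ X → 2 ^ i ≤ 2 ^ X := fun h => Nat.pow_le_pow_right two_pos h
  have hwX : N.weight + 1 ≤ 2 ^ X := N.weight_lt_two_pow_size.trans_le (hpow hN)
  obtain ⟨z, k, K, h1, h2, h3, h4, h5, h6⟩ := h.exists_small_solution
  set w := N.weight
  obtain ⟨E, hE⟩ : ∃ E, E = (X + 1) + ((X + 1) * (X + 1) + (3 * X + 5) * (X + 1)) := ⟨_, rfl⟩
  rw [← hE]
  have hK : K ≤ 2 ^ E := by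
    rw [h6, hE]
    refine kernel_bound_le X _ _ _ (by omega)
      (N.card_places_lt_two_pow_size.le.trans (hpow hN)) ?_
    have a1 := (Nat.lt_size_self (vecSize M)).trans_le (hpow (show _ ≤ X by omega))
    have a2 := (Nat.lt_size_self (vecSize M')).trans_le (hpow (show _ ≤ X by omega))
    have a3 : 2 ^ (X + 2) = 4 * 2 ^ X := by ring
    omega
  have hsum : ∑ t, z t ≤ 2 ^ (X + E) := by
    calc ∑ t, z t ≤ Fintype.card T * K := by
          simpa using Finset.sum_le_card_nsmul Finset.univ z K fun t _ => h5 t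
      _ ≤ 2 ^ X * 2 ^ E := Nat.mul_le_mul ((hT.trans hN).trans Nat.lt_two_pow_self.le) hK
      _ = _ := by rw [pow_add _ X E]
  have hm : (contSupp σ).ncard ≤ X := by
    refine le_trans ?_ (hT.trans hN)
    rw [← Nat.card_eq_fintype_card, ← Set.ncard_univ]
    exact Set.ncard_le_ncard (Set.subset_univ _)
  have hb : 2 * (w + 1) ^ (contSupp σ).ncard ≤ 2 ^ (X ^ 2 + 1) :=
    calc 2 * (w + 1) ^ (contSupp σ).ncard ≤ 2 * (2 ^ X) ^ X := by
          refine Nat.mul_le_mul_left _ ?_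
          exact (Nat.pow_le_pow_left hwX _).trans (Nat.pow_le_pow_right (by positivity) hm)
      _ = 2 ^ (X ^ 2 + 1) := by rw [← pow_mul]; ring
  set b := 2 ^ (X ^ 2 + 1)
  have hg : w * (b * ∑ t, z t) ≤ 2 ^ (X + (X ^ 2 + 1 + (X + E))) := by
    rw [pow_add, pow_add _ (X ^ 2 + 1)]
    gcongr
    omega
  -- Here `g` and `b` are rounded up to powers of two. With `k ≤ 2 ^ E` the exponents add up to `2 *
  -- E + 2 * X ^ 2 + 2 * X + 2`, below the claimed bound.
  refine ⟨2 ^ (X + (X ^ 2 + 1 + (X + E))) * b * k, ?_, ?_,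
    h.exists_firesSeq_smul hw z k b _ h1 h2 h3 hb hg Nat.one_le_two_pow⟩
  · exact Nat.mul_pos (Nat.mul_pos (by positivity) (by positivity)) h1
  · rw [Nat.size_le]
    calc 2 ^ (X + (X ^ 2 + 1 + (X + E))) * b * k
        ≤ 2 ^ (X + (X ^ 2 + 1 + (X + E))) * 2 ^ (X ^ 2 + 1) * 2 ^ E := by
          gcongr
          exact h4.trans hK
      _ = 2 ^ (X + (X ^ 2 + 1 + (X + E)) + (X ^ 2 + 1) + E) := by
          rw [pow_add _ _ E, pow_add _ _ (X ^ 2 + 1)]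
      _ < _ := Nat.pow_lt_pow_right (by norm_num) (by omega)

end PetriNet

theorem mainTheorem3 :
    (∃ q : Polynomial ℕ,
      ∀ (P : Type u) (T : Type v) [Fintype P] [Fintype T] (N : PetriNet P T)
        (M M' : P → ℕ) (σ : List (ℚ≥0 × T)),
        N.ContFiresSeq (toContMarking M) σ (toContMarking M') →
        ∃ n : ℕ, 1 ≤ n ∧
          Nat.size n ≤ q.eval (N.size * (Nat.size (vecSize M) + Nat.size (vecSize M'))) ∧
          ∃ τ : List T, seqSupp τ = contSupp σ ∧ N.FiresSeq (n • M) τ (n • M')) ∧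
    (∀ (P : Type u) (T : Type v) [Fintype P] [Fintype T] (N : PetriNet P T)
        (M M' : P → ℕ) (σ : List (ℚ≥0 × T)),
        N.ContFiresSeq (toContMarking M) σ (toContMarking M') →
        ∃ k : ℕ, IsLeastDenominator (contParikh σ) k ∧
          ∃ n : ℕ,
            (n : ℚ≥0) = 16 * (N.weight : ℚ≥0) * ((N.weight : ℚ≥0) + 1) ^ (2 * (contSupp σ).ncard) *
              (k : ℚ≥0) ^ 2 * vecSize (contParikh σ) ∧
            ∃ τ : List T, seqSupp τ = contSupp σ ∧ N.FiresSeq (n • M) τ (n • M')) := by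
  refine ⟨⟨3 * ((.X + 1) + ((.X + 1) * (.X + 1) + (3 * .X + 5) * (.X + 1))) + 2 * .X ^ 2 +
      2 * .X + 10, ?_⟩, ?_⟩
  · intro P T _ _ N M M' σ h
    simpa using h.exists_small_firesSeq _ rfl
  · intro P T _ _ N M M' σ h
    obtain ⟨k, hk⟩ := PetriNet.exists_isLeastDenominator (contParikh σ)
    exact ⟨k, hk, h.exists_firesSeq_of_denominator k hk.1.1 hk.1.2⟩
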